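/- Let $d\ge 1$ be an integer and let $s$ be a real number with $-1/d<s<0$; put $r:=-1/s$. A function $p:\mathbb{R}^d\to[0,\infty)$ is called $s$-concave if for all $x_0,x_1\in\mathbb{R}^d$ and all $\theta\in(0,1)$ one has $p((1-\theta)x_0+\theta x_1)\ge M_s(p(x_0),p(x_1);\theta)$, where $M_s(a,b;\theta):=\big((1-\theta)a^s+\theta b^s\big)^{1/s}$ if $a,b>0$ and $M_s(a,b;\theta):=0$ if $ab=0$. Let $\nu,\nu_1,\nu_2,\ldots$ be probability measures on $\mathbb{R}^d$ having upper semicontinuous $s$-concave densities $f,f_1,f_2,\ldots:\mathbb{R}^d\to[0,\infty)$ with respect to Lebesgue measure, and suppose that $\nu_n\to\nu$ weakly as $n\to\infty$. Then for every real number $\kappa<r-d$, the function $x\mapsto(1+\|x\|)^\kappa|f_n(x)-f(x)|$ is Lebesgue integrable for every $n$, and $$\lim_{n\to\infty}\int_{\mathbb{R}^d}(1+\|x\|)^\kappa\,|f_n(x)-f(x)|\,dx=0,$$ where $\|\cdot\|$ is the Euclidean norm. -/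

import Mathlib

open MeasureTheory Filter Topology

noncomputable section

/-- The generalized mean `M_s(a, b; θ)` of order `s ∈ ℝ` of two nonnegative numbers:
`0` if one of them vanishes, the weighted geometric mean for `s = 0`, and
`((1 - θ) a ^ s + θ b ^ s) ^ (1 / s)` otherwise. -/
def generalizedMean (s a b θ : ℝ) : ℝ :=
  if a * b = 0 then 0
  else if s = 0 then a ^ (1 - θ) * b ^ θ
  else ((1 - θ) * a ^ s + θ * b ^ s) ^ (1 / s)

/-- A nonnegative function `p` on `ℝ^d` is `s`-concave if
`p ((1 - θ) x₀ + θ x₁) ≥ M_s (p x₀, p x₁; θ)` for all `x₀, x₁` and all `θ ∈ (0, 1)`. -/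
def IsSConcave {d : ℕ} (s : ℝ) (p : EuclideanSpace ℝ (Fin d) → ℝ) : Prop :=
  (∀ x, 0 ≤ p x) ∧
    ∀ x₀ x₁ : EuclideanSpace ℝ (Fin d), ∀ θ ∈ Set.Ioo (0 : ℝ) 1,
      generalizedMean s (p x₀) (p x₁) θ ≤ p ((1 - θ) • x₀ + θ • x₁)

/-- `p` is a (real-valued, nonnegative) Lebesgue density of the probability measure `ν`. -/
def IsLebesgueDensity {d : ℕ} (p : EuclideanSpace ℝ (Fin d) → ℝ)
    (ν : ProbabilityMeasure (EuclideanSpace ℝ (Fin d))) : Prop :=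
  Measurable p ∧ (∀ x, 0 ≤ p x) ∧
    (ν : Measure (EuclideanSpace ℝ (Fin d))) =
      volume.withDensity (fun x => ENNReal.ofReal (p x))

end

/-! The proof is dominated convergence. Superlevel sets of the densities are convex, so their
frontiers are null, and weak convergence controls the masses of balls; `s`-concavity turns masses
into pointwise values. Separation by hyperplanes gives lower bounds inside superlevel sets of `f`
(`eventually_le_on_ball_of_mem_interior`); a value of `fn n` well above `f` would put too much mass
on a small ball (`eventually_lt_of_weak`). Hence `fn n → f` a.e. A fixed ball where `fn n` is
bounded below, with tightness, gives the common majorant `K (1 + ‖x‖) ^ (1 / s)`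
(`eventually_le_rpow_of_weak`), integrable against the weight because `κ + 1 / s < -d`. -/

/-- An `s`-concave function with `s < 0` dominates the generalized mean of any positive lower
bounds of its values. -/
theorem IsSConcave.mean_le {d : ℕ} {s : ℝ} {p : EuclideanSpace ℝ (Fin d) → ℝ}
    (hp : IsSConcave s p) (hs : s < 0) {x y : EuclideanSpace ℝ (Fin d)} {a b θ : ℝ}
    (ha : 0 < a) (hb : 0 < b) (hax : a ≤ p x) (hby : b ≤ p y) (h0 : 0 < θ) (h1 : θ < 1) :
    ((1 - θ) * a ^ s + θ * b ^ s) ^ (1 / s) ≤ p ((1 - θ) • x + θ • y) := by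
  have hx : 0 < p x := ha.trans_le hax
  have hy : 0 < p y := hb.trans_le hby
  have h := hp.2 x y θ ⟨h0, h1⟩
  rw [generalizedMean, if_neg (mul_pos hx hy).ne', if_neg hs.ne] at h
  refine le_trans (Real.rpow_le_rpow_of_nonpos ?_ ?_ ?_) h
  · have := Real.rpow_pos_of_pos hx s
    have := Real.rpow_pos_of_pos hy s
    have : 0 < 1 - θ := by linarith
    positivity
  · have := Real.rpow_le_rpow_of_nonpos ha hax hs.le
    have := Real.rpow_le_rpow_of_nonpos hb hby hs.le
    have : 0 ≤ 1 - θ := by linarith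
    gcongr
  · exact (one_div_neg.2 hs).le

theorem IsSConcave.le_combo {d : ℕ} {s : ℝ} {p : EuclideanSpace ℝ (Fin d) → ℝ}
    (hp : IsSConcave s p) (hs : s < 0) {x y : EuclideanSpace ℝ (Fin d)} {c θ : ℝ}
    (hc : 0 < c) (hx : c ≤ p x) (hy : c ≤ p y) (h0 : 0 < θ) (h1 : θ < 1) :
    c ≤ p ((1 - θ) • x + θ • y) := by
  have h := hp.mean_le hs hc hc hx hy h0 h1
  rwa [show (1 - θ) * c ^ s + θ * c ^ s = c ^ s by ring, ← Real.rpow_mul hc.le,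
    mul_one_div_cancel hs.ne, Real.rpow_one] at h

theorem IsSConcave.convex_superlevel {d : ℕ} {s : ℝ} {p : EuclideanSpace ℝ (Fin d) → ℝ}
    (hp : IsSConcave s p) (hs : s < 0) {c : ℝ} (hc : 0 < c) : Convex ℝ {x | c ≤ p x} := by
  refine convex_iff_forall_pos.2 fun x hx y hy a b ha hb hab => ?_
  obtain rfl : a = 1 - b := by linarith
  exact hp.le_combo hs hc hx hy hb (by linarith)

/-- A lower bound at a point and one on a ball propagate to the balls of the cone they span. -/
theorem IsSConcave.mean_le_on_ball {d : ℕ} {s : ℝ} {p : EuclideanSpace ℝ (Fin d) → ℝ}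
    (hp : IsSConcave s p) (hs : s < 0) {x z : EuclideanSpace ℝ (Fin d)} {a b θ δ : ℝ}
    (ha : 0 < a) (hb : 0 < b) (hax : a ≤ p x) (hbz : ∀ y ∈ Metric.ball z δ, b ≤ p y)
    (h0 : 0 < θ) (h1 : θ < 1) :
    ∀ w ∈ Metric.ball ((1 - θ) • x + θ • z) (θ * δ),
      ((1 - θ) * a ^ s + θ * b ^ s) ^ (1 / s) ≤ p w := by
  intro w hw
  -- Solve for the point of the ball about `z` whose segment from `x` passes through `w`.
  have hw' : w = (1 - θ) • x + θ • (z + θ⁻¹ • (w - ((1 - θ) • x + θ • z))) := by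
    rw [smul_add, smul_smul, mul_inv_cancel₀ h0.ne']; module
  rw [hw']
  refine hp.mean_le hs ha hb hax (hbz _ ?_) h0 h1
  rw [mem_ball_iff_norm] at hw ⊢
  rw [add_sub_cancel_left, norm_smul, norm_inv, Real.norm_of_nonneg h0.le,
    inv_mul_lt_iff₀ h0]
  exact hw

/-! ### Masses of balls -/

theorem IsLebesgueDensity.mul_volume_le {d : ℕ} {p : EuclideanSpace ℝ (Fin d) → ℝ}
    {ν : ProbabilityMeasure (EuclideanSpace ℝ (Fin d))} (hp : IsLebesgueDensity p ν)
    {x : EuclideanSpace ℝ (Fin d)} {r c : ℝ} (hc : 0 ≤ c) (h : ∀ y ∈ Metric.ball x r, c ≤ p y) :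
    c * volume.real (Metric.ball x r) ≤
      (ν : Measure (EuclideanSpace ℝ (Fin d))).real (Metric.ball x r) := by
  have key : ENNReal.ofReal c * volume (Metric.ball x r) ≤
      (ν : Measure (EuclideanSpace ℝ (Fin d))) (Metric.ball x r) := by
    rw [hp.2.2, withDensity_apply _ Metric.isOpen_ball.measurableSet, ← setLIntegral_const]
    exact setLIntegral_mono' Metric.isOpen_ball.measurableSet
      fun y hy => ENNReal.ofReal_le_ofReal (h y hy)
  have := ENNReal.toReal_mono (measure_ne_top _ _) key
  rwa [ENNReal.toReal_mul, ENNReal.toReal_ofReal hc] at this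

theorem IsLebesgueDensity.le_mul_volume {d : ℕ} {p : EuclideanSpace ℝ (Fin d) → ℝ}
    {ν : ProbabilityMeasure (EuclideanSpace ℝ (Fin d))} (hp : IsLebesgueDensity p ν)
    {x : EuclideanSpace ℝ (Fin d)} {r c : ℝ} (hc : 0 ≤ c) (h : ∀ y ∈ Metric.ball x r, p y ≤ c) :
    (ν : Measure (EuclideanSpace ℝ (Fin d))).real (Metric.ball x r) ≤
      c * volume.real (Metric.ball x r) := by
  have key : (ν : Measure (EuclideanSpace ℝ (Fin d))) (Metric.ball x r) ≤
      ENNReal.ofReal c * volume (Metric.ball x r) := by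
    rw [hp.2.2, withDensity_apply _ Metric.isOpen_ball.measurableSet, ← setLIntegral_const]
    exact setLIntegral_mono' Metric.isOpen_ball.measurableSet
      fun y hy => ENNReal.ofReal_le_ofReal (h y hy)
  have := ENNReal.toReal_mono
    (ENNReal.mul_ne_top ENNReal.ofReal_ne_top measure_ball_lt_top.ne) key
  rwa [ENNReal.toReal_mul, ENNReal.toReal_ofReal hc] at this

theorem volume_real_ball_pos {d : ℕ} (x : EuclideanSpace ℝ (Fin d)) {r : ℝ} (hr : 0 < r) :
    0 < volume.real (Metric.ball x r) :=
  ENNReal.toReal_pos (Metric.measure_ball_pos _ _ hr).ne' measure_ball_lt_top.ne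

theorem IsLebesgueDensity.exists_lt_of_mul_volume_lt {d : ℕ} {p : EuclideanSpace ℝ (Fin d) → ℝ}
    {ν : ProbabilityMeasure (EuclideanSpace ℝ (Fin d))} (hp : IsLebesgueDensity p ν)
    {x : EuclideanSpace ℝ (Fin d)} {r c : ℝ} (hc : 0 ≤ c)
    (h : c * volume.real (Metric.ball x r) <
      (ν : Measure (EuclideanSpace ℝ (Fin d))).real (Metric.ball x r)) :
    ∃ y ∈ Metric.ball x r, c < p y := by
  by_contra! hcon
  exact absurd (hp.le_mul_volume hc hcon) (not_le.2 h)

/-- Weak convergence to a measure with a density implies convergence of the masses of balls. -/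
theorem IsLebesgueDensity.tendsto_real_ball {d : ℕ} {f : EuclideanSpace ℝ (Fin d) → ℝ}
    {ν : ProbabilityMeasure (EuclideanSpace ℝ (Fin d))}
    {νn : ℕ → ProbabilityMeasure (EuclideanSpace ℝ (Fin d))}
    (hf : IsLebesgueDensity f ν) (hweak : Tendsto νn atTop (𝓝 ν))
    (x : EuclideanSpace ℝ (Fin d)) (r : ℝ) :
    Tendsto (fun n => (νn n : Measure (EuclideanSpace ℝ (Fin d))).real (Metric.ball x r)) atTop
      (𝓝 ((ν : Measure (EuclideanSpace ℝ (Fin d))).real (Metric.ball x r))) := by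
  refine (ENNReal.tendsto_toReal (measure_ne_top _ _)).comp
    (ProbabilityMeasure.tendsto_measure_of_null_frontier_of_tendsto' hweak ?_)
  have hac : (ν : Measure (EuclideanSpace ℝ (Fin d))) ≪ volume := by
    rw [hf.2.2]; exact withDensity_absolutelyContinuous _ _
  exact hac ((convex_ball x r).addHaar_frontier volume)

/-! ### Almost everywhere convergence -/

/-- Near an interior point of `{q ≤ f}`, the densities `fn n` are eventually at least `c < q`. -/
theorem eventually_le_on_ball_of_mem_interior {d : ℕ} {s : ℝ} (hs : s < 0)
    {ν : ProbabilityMeasure (EuclideanSpace ℝ (Fin d))}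
    {νn : ℕ → ProbabilityMeasure (EuclideanSpace ℝ (Fin d))}
    {f : EuclideanSpace ℝ (Fin d) → ℝ} {fn : ℕ → EuclideanSpace ℝ (Fin d) → ℝ}
    (hf : IsLebesgueDensity f ν) (hfn : ∀ n, IsLebesgueDensity (fn n) (νn n))
    (hfn_usc : ∀ n, UpperSemicontinuous (fn n)) (hfn_conc : ∀ n, IsSConcave s (fn n))
    (hweak : Tendsto νn atTop (𝓝 ν)) {x : EuclideanSpace ℝ (Fin d)} {q c : ℝ}
    (hx : x ∈ interior {y | q ≤ f y}) (hc : 0 < c) (hcq : c < q) :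
    ∃ δ > 0, ∀ᶠ n in atTop, ∀ y ∈ Metric.ball x δ, c ≤ fn n y := by
  obtain ⟨ε, hε, hball⟩ := Metric.mem_nhds_iff.1 (mem_interior_iff_mem_nhds.1 hx)
  -- Finitely many test balls, displaced from `x` in directions `u`, serve every possible normal, so
  -- one threshold for `n` suffices. The index `0` handles a zero functional.
  obtain ⟨t, -, htfin, hcov⟩ := (isCompact_sphere (0 : EuclideanSpace ℝ (Fin d)) 1).finite_cover_balls
    (show (0 : ℝ) < 1 / 4 by norm_num)
  have htb : ∀ u ∈ insert 0 t ∩ Metric.ball (0 : EuclideanSpace ℝ (Fin d)) 2, ∀ᶠ n in atTop,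
      c * volume.real (Metric.ball (x - (ε / 4) • u) (ε / 16)) <
        (νn n : Measure (EuclideanSpace ℝ (Fin d))).real
          (Metric.ball (x - (ε / 4) • u) (ε / 16)) := by
    intro u hu
    refine (hf.tendsto_real_ball hweak _ _).eventually_const_lt ?_
    refine lt_of_lt_of_le (mul_lt_mul_of_pos_right hcq (volume_real_ball_pos _ (by positivity)))
      (hf.mul_volume_le (hc.trans hcq).le fun y hy => hball ?_)
    have hu2 : ‖u‖ < 2 := mem_ball_zero_iff.1 hu.2
    rw [mem_ball_iff_norm] at hy ⊢
    calc ‖y - x‖ = ‖(y - (x - (ε / 4) • u)) - (ε / 4) • u‖ := by congr 1; abel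
      _ ≤ ‖y - (x - (ε / 4) • u)‖ + ‖(ε / 4) • u‖ := norm_sub_le _ _
      _ < ε := by
        rw [norm_smul, Real.norm_of_nonneg (by positivity)]
        nlinarith
  refine ⟨ε / 16, by positivity, ?_⟩
  filter_upwards [((htfin.insert 0).inter_of_left _).eventually_all.2 htb] with n hn y hy
  by_contra hcon
  -- The test ball displaced against the normal of `g` lies strictly on the side of `y`, yet has
  -- enough mass to meet the superlevel set.
  obtain ⟨g, u₀, hgy, hgK⟩ := geometric_hahn_banach_point_closed
    ((hfn_conc n).convex_superlevel hs hc)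
    (upperSemicontinuous_iff_isClosed_preimage.1 (hfn_usc n) c) hcon
  have hlow : ∀ u ∈ insert 0 t ∩ Metric.ball (0 : EuclideanSpace ℝ (Fin d)) 2,
      ∃ z ∈ Metric.ball (x - (ε / 4) • u) (ε / 16), g y < g z := by
    intro u hu
    obtain ⟨z, hz, hcz⟩ := (hfn n).exists_lt_of_mul_volume_lt hc.le (hn u hu)
    exact ⟨z, hz, hgy.trans (hgK z hcz.le)⟩
  rcases eq_or_ne g 0 with rfl | hg
  · obtain ⟨z, -, hz⟩ := hlow 0 ⟨by simp, by simp⟩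
    simp at hz
  set v := (InnerProductSpace.toDual ℝ (EuclideanSpace ℝ (Fin d))).symm g with hv
  have hgv : ∀ w, g w = inner ℝ v w := fun w => by
    rw [hv, InnerProductSpace.toDual_symm_apply]
  have hv0 : 0 < ‖v‖ := by
    rw [norm_pos_iff, hv]; simpa using hg
  have hunit : ‖v‖⁻¹ • v ∈ Metric.sphere (0 : EuclideanSpace ℝ (Fin d)) 1 := by
    simp [norm_smul, hv0.ne']
  obtain ⟨u, hut, hvu⟩ := Set.mem_iUnion₂.1 (hcov hunit)
  rw [mem_ball_iff_norm] at hvu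
  have hu2 : ‖u‖ < 2 := by
    have h1 := norm_sub_norm_le u (‖v‖⁻¹ • v)
    rw [norm_sub_rev, mem_sphere_zero_iff_norm.1 hunit] at h1
    linarith
  obtain ⟨z, hz, hgz⟩ := hlow u ⟨by simp [hut], by simpa using hu2⟩
  have hvv : inner ℝ v u = ‖v‖ - inner ℝ v (‖v‖⁻¹ • v - u) := by
    rw [inner_sub_right, inner_smul_right, real_inner_self_eq_norm_sq]
    field_simp; ring
  have hb1 : inner ℝ v (‖v‖⁻¹ • v - u) ≤ ‖v‖ * (1 / 4) :=
    (real_inner_le_norm _ _).trans (by gcongr)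
  have hb2 : inner ℝ v (z - (x - (ε / 4) • u)) ≤ ‖v‖ * (ε / 16) :=
    (real_inner_le_norm _ _).trans (by gcongr; exact (mem_ball_iff_norm.1 hz).le)
  have hb3 : inner ℝ v (x - y) ≤ ‖v‖ * (ε / 16) :=
    (real_inner_le_norm _ _).trans (by gcongr; exact (mem_ball_iff_norm'.1 hy).le)
  rw [hgv, hgv] at hgz
  rw [inner_sub_right, inner_sub_right, inner_smul_right] at hb2
  rw [inner_sub_right] at hb3
  nlinarith [mul_pos hv0 hε]

/-- Convex sets have null frontier; rational levels keep the exceptional set null. -/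
theorem IsSConcave.ae_notMem_frontier {d : ℕ} {s : ℝ} {p : EuclideanSpace ℝ (Fin d) → ℝ}
    (hp : IsSConcave s p) (hs : s < 0) :
    ∀ᵐ x, ∀ q : ℚ, 0 < q → x ∉ frontier {y | (q : ℝ) ≤ p y} := by
  refine ae_all_iff.2 fun q => ?_
  by_cases hq : 0 < q
  · have h := (hp.convex_superlevel hs (Rat.cast_pos.2 hq)).addHaar_frontier volume
    filter_upwards [measure_eq_zero_iff_ae_notMem.1 h] with x hx _ using hx
  · exact .of_forall fun x h => absurd h hq

theorem IsLebesgueDensity.exists_mem_interior {d : ℕ} {s : ℝ} (hs : s < 0)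
    {f : EuclideanSpace ℝ (Fin d) → ℝ} {ν : ProbabilityMeasure (EuclideanSpace ℝ (Fin d))}
    (hf : IsLebesgueDensity f ν) (hconc : IsSConcave s f) :
    ∃ q : ℝ, 0 < q ∧ ∃ z, z ∈ interior {y | q ≤ f y} := by
  by_contra! hcon
  have h0 : ∀ᵐ x, ENNReal.ofReal (f x) = 0 := by
    filter_upwards [hconc.ae_notMem_frontier hs] with x hx
    rw [ENNReal.ofReal_eq_zero]
    by_contra! hpos
    obtain ⟨q, hq0, hq⟩ := exists_rat_btwn hpos
    have hq0' : 0 < q := Rat.cast_pos.1 hq0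
    exact hx q hq0' ⟨subset_closure hq.le, hcon q hq0 x⟩
  have h1 : (ν : Measure (EuclideanSpace ℝ (Fin d))) Set.univ = 0 := by
    rw [hf.2.2, withDensity_congr_ae (g := 0) h0]; simp
  simp at h1

/-- Pointwise upper bound for weakly convergent `s`-concave densities. -/
theorem eventually_lt_of_weak {d : ℕ} {s : ℝ} (hs : s < 0)
    {ν : ProbabilityMeasure (EuclideanSpace ℝ (Fin d))}
    {νn : ℕ → ProbabilityMeasure (EuclideanSpace ℝ (Fin d))}
    {f : EuclideanSpace ℝ (Fin d) → ℝ} {fn : ℕ → EuclideanSpace ℝ (Fin d) → ℝ}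
    (hf : IsLebesgueDensity f ν) (hf_usc : UpperSemicontinuous f)
    (hfn : ∀ n, IsLebesgueDensity (fn n) (νn n)) (hfn_conc : ∀ n, IsSConcave s (fn n))
    (hweak : Tendsto νn atTop (𝓝 ν)) {z : EuclideanSpace ℝ (Fin d)} {m δ : ℝ} (hm : 0 < m)
    (hδ : 0 < δ) (hz : ∀ᶠ n in atTop, ∀ y ∈ Metric.ball z δ, m ≤ fn n y)
    {x : EuclideanSpace ℝ (Fin d)} {c : ℝ} (hc : f x < c) :
    ∀ᶠ n in atTop, fn n x < c := by
  obtain ⟨c₁, hxc₁, hc₁⟩ := exists_between hc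
  obtain ⟨c₂, hc₁₂, hc₂⟩ := exists_between hc₁
  have hc₁0 : 0 < c₁ := (hf.2.1 x).trans_lt hxc₁
  have hc0 : 0 < c := hc₁0.trans hc₁
  obtain ⟨ε, hε, hball⟩ := Metric.mem_nhds_iff.1 (hf_usc x c₁ hxc₁)
  -- As `θ → 0` the cone from `x` to the ball at `z` keeps a bound above `c₂`, on a ball shrinking
  -- to `x` where `f < c₁ < c₂`.
  have hmean : Tendsto (fun θ : ℝ => ((1 - θ) * c ^ s + θ * m ^ s) ^ (1 / s)) (𝓝[>] 0) (𝓝 c) := by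
    have h0 : Tendsto (fun θ : ℝ => (1 - θ) * c ^ s + θ * m ^ s) (𝓝[>] 0) (𝓝 (c ^ s)) := by
      have : Continuous fun θ : ℝ => (1 - θ) * c ^ s + θ * m ^ s := by fun_prop
      simpa using (this.tendsto 0).mono_left nhdsWithin_le_nhds
    have := h0.rpow_const (p := 1 / s) (.inl (Real.rpow_pos_of_pos hc0 s).ne')
    rwa [← Real.rpow_mul hc0.le, mul_one_div_cancel hs.ne, Real.rpow_one] at this
  have hsmall : Tendsto (fun θ : ℝ => θ * (‖z - x‖ + δ)) (𝓝[>] 0) (𝓝 0) := by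
    have : Continuous fun θ : ℝ => θ * (‖z - x‖ + δ) := by fun_prop
    simpa using (this.tendsto 0).mono_left nhdsWithin_le_nhds
  obtain ⟨θ, hθc, hθε, hθ0, hθ1⟩ := ((hmean.eventually_const_lt hc₂).and
    ((hsmall.eventually_lt_const hε).and
      (Ioo_mem_nhdsGT (zero_lt_one' ℝ) : ∀ᶠ θ : ℝ in 𝓝[>] 0, θ ∈ Set.Ioo 0 1))).exists
  set w := (1 - θ) • x + θ • z with hw
  have hsub : ∀ y ∈ Metric.ball w (θ * δ), f y ≤ c₁ := fun y hy => by
    refine (hball ?_ : f y < c₁).le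
    rw [mem_ball_iff_norm] at hy ⊢
    calc ‖y - x‖ = ‖(y - w) + θ • (z - x)‖ := by congr 1; rw [hw]; module
      _ ≤ ‖y - w‖ + ‖θ • (z - x)‖ := norm_add_le _ _
      _ < ε := by rw [norm_smul, Real.norm_of_nonneg hθ0.le]; linarith
  have hmass := (hf.tendsto_real_ball hweak w (θ * δ)).eventually_lt_const
    ((hf.le_mul_volume hc₁0.le hsub).trans_lt
      (mul_lt_mul_of_pos_right hc₁₂ (volume_real_ball_pos _ (mul_pos hθ0 hδ))))
  filter_upwards [hmass, hz] with n hn hzn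
  by_contra! hcon
  refine absurd hn (not_lt.2 ((hfn n).mul_volume_le (hc₁0.trans hc₁₂).le fun y hy => ?_))
  exact hθc.le.trans ((hfn_conc n).mean_le_on_ball hs hc0 hm hcon hzn hθ0 hθ1 y hy)

theorem ae_tendsto_of_weak {d : ℕ} {s : ℝ} (hs : s < 0)
    {ν : ProbabilityMeasure (EuclideanSpace ℝ (Fin d))}
    {νn : ℕ → ProbabilityMeasure (EuclideanSpace ℝ (Fin d))}
    {f : EuclideanSpace ℝ (Fin d) → ℝ} {fn : ℕ → EuclideanSpace ℝ (Fin d) → ℝ}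
    (hf : IsLebesgueDensity f ν) (hf_usc : UpperSemicontinuous f) (hf_conc : IsSConcave s f)
    (hfn : ∀ n, IsLebesgueDensity (fn n) (νn n)) (hfn_usc : ∀ n, UpperSemicontinuous (fn n))
    (hfn_conc : ∀ n, IsSConcave s (fn n)) (hweak : Tendsto νn atTop (𝓝 ν)) :
    ∀ᵐ x, Tendsto (fun n => fn n x) atTop (𝓝 (f x)) := by
  obtain ⟨q, hq, z, hz⟩ := hf.exists_mem_interior hs hf_conc
  obtain ⟨δ, hδ, hball⟩ := eventually_le_on_ball_of_mem_interior hs hf hfn hfn_usc hfn_conc hweak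
    hz (half_pos hq) (half_lt_self hq)
  filter_upwards [hf_conc.ae_notMem_frontier hs] with x hx
  refine tendsto_order.2 ⟨fun c hc => ?_, fun c hc =>
    eventually_lt_of_weak hs hf hf_usc hfn hfn_conc hweak (half_pos hq) hδ hball hc⟩
  rcases lt_or_ge c 0 with hc0 | hc0
  · exact .of_forall fun n => hc0.trans_le ((hfn n).2.1 x)
  obtain ⟨c', hcc', hc'⟩ := exists_between hc
  obtain ⟨a, hca, ha⟩ := exists_rat_btwn hc'
  have ha0 : (0 : ℝ) < a := hc0.trans_lt (hcc'.trans hca)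
  have hint : x ∈ interior {y | (a : ℝ) ≤ f y} := by
    by_contra hcon
    exact hx a (Rat.cast_pos.1 ha0) ⟨subset_closure ha.le, hcon⟩
  obtain ⟨η, hη, hev⟩ := eventually_le_on_ball_of_mem_interior hs hf hfn hfn_usc hfn_conc hweak
    hint (hc0.trans_lt hcc') hca
  filter_upwards [hev] with n hn
  exact hcc'.trans_le (hn x (Metric.mem_ball_self hη))

/-! ### Uniform decay -/

/-- A bound on the maximum of an `s`-concave density in terms of a lower bound on a ball. -/
theorem exists_sup_bound {d : ℕ} {s : ℝ} (hs : s < 0) (hsd : 1 / s + d < 0) {m δ : ℝ}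
    (hm : 0 < m) (hδ : 0 < δ) :
    ∃ H > 0, ∀ (p : EuclideanSpace ℝ (Fin d) → ℝ) (ν : ProbabilityMeasure (EuclideanSpace ℝ (Fin d)))
      (z : EuclideanSpace ℝ (Fin d)), IsLebesgueDensity p ν → IsSConcave s p →
        (∀ y ∈ Metric.ball z δ, m ≤ p y) → ∀ x, p x ≤ H := by
  set V := volume.real (Metric.ball (0 : EuclideanSpace ℝ (Fin d)) δ) with hV
  have hVpos : 0 < V := volume_real_ball_pos _ hδ
  -- A value above `θ ^ (1 / s) * m` forces mass at least `2 ^ (1 / s) * m * V * θ ^ (1 / s + d)`,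
  -- which exceeds `1` for small `θ`.
  obtain ⟨θ, hθV, hθ0, hθ1⟩ := (((tendsto_rpow_neg_nhdsGT_zero hsd).eventually_gt_atTop
    (1 / ((2 : ℝ) ^ (1 / s) * m * V))).and
      (Ioo_mem_nhdsGT (zero_lt_one' ℝ) : ∀ᶠ θ : ℝ in 𝓝[>] 0, θ ∈ Set.Ioo 0 1)).exists
  have hθm : 0 < θ ^ (1 / s) * m := mul_pos (Real.rpow_pos_of_pos hθ0 _) hm
  refine ⟨θ ^ (1 / s) * m, hθm, fun p ν z hp hconc hz x => ?_⟩
  by_contra! hcon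
  have hms : 0 < m ^ s := Real.rpow_pos_of_pos hm s
  have hlow : ∀ w ∈ Metric.ball ((1 - θ) • x + θ • z) (θ * δ),
      (2 : ℝ) ^ (1 / s) * θ ^ (1 / s) * m ≤ p w := fun w hw => by
    refine le_trans ?_ (hconc.mean_le_on_ball hs hθm hm hcon.le hz hθ0 hθ1 w hw)
    have h1 : (2 : ℝ) ^ (1 / s) * θ ^ (1 / s) * m = (2 * θ * m ^ s) ^ (1 / s) := by
      rw [Real.mul_rpow (by positivity) hms.le, Real.mul_rpow (by positivity) hθ0.le,
        ← Real.rpow_mul hm.le, mul_one_div_cancel hs.ne, Real.rpow_one]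
    have h2 : (θ ^ (1 / s) * m) ^ s = θ * m ^ s := by
      rw [Real.mul_rpow (by positivity) hm.le, ← Real.rpow_mul hθ0.le, one_div_mul_cancel hs.ne,
        Real.rpow_one]
    rw [h1, h2]
    have h1θ : 0 < 1 - θ := by linarith
    refine Real.rpow_le_rpow_of_nonpos (by positivity) ?_ (one_div_neg.2 hs).le
    nlinarith [mul_pos (mul_pos hθ0 hθ0) hms]
  have hmass := (hp.mul_volume_le (by positivity) hlow).trans measureReal_le_one
  have hvol : volume.real (Metric.ball ((1 - θ) • x + θ • z) (θ * δ)) = θ ^ (d : ℝ) * V := by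
    rw [measureReal_def, Measure.addHaar_ball_mul_of_pos _ _ hθ0, ENNReal.toReal_mul,
      ENNReal.toReal_ofReal (by positivity), finrank_euclideanSpace_fin, Real.rpow_natCast, hV,
      measureReal_def]
  rw [hvol] at hmass
  rw [div_lt_iff₀ (by positivity), Real.rpow_add hθ0] at hθV
  linarith

/-- Uniform polynomial decay of weakly convergent `s`-concave densities. -/
theorem eventually_le_rpow_of_weak {d : ℕ} {s : ℝ} (hs : s < 0) (hsd : 1 / s + d < 0)
    {ν : ProbabilityMeasure (EuclideanSpace ℝ (Fin d))}
    {νn : ℕ → ProbabilityMeasure (EuclideanSpace ℝ (Fin d))}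
    {f : EuclideanSpace ℝ (Fin d) → ℝ} {fn : ℕ → EuclideanSpace ℝ (Fin d) → ℝ}
    (hf : IsLebesgueDensity f ν) (hf_conc : IsSConcave s f)
    (hfn : ∀ n, IsLebesgueDensity (fn n) (νn n)) (hfn_usc : ∀ n, UpperSemicontinuous (fn n))
    (hfn_conc : ∀ n, IsSConcave s (fn n)) (hweak : Tendsto νn atTop (𝓝 ν)) :
    ∃ K, ∀ᶠ n in atTop, ∀ x, fn n x ≤ K * (1 + ‖x‖) ^ (1 / s) := by
  obtain ⟨q, hq, z, hz⟩ := hf.exists_mem_interior hs hf_conc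
  obtain ⟨δ, hδ, hball⟩ := eventually_le_on_ball_of_mem_interior hs hf hfn hfn_usc hfn_conc hweak
    hz (half_pos hq) (half_lt_self hq)
  set m := q / 2 with hmdef
  have hm : 0 < m := half_pos hq
  obtain ⟨H, hH, hHbd⟩ := exists_sup_bound (d := d) hs hsd hm hδ
  have hs' : 1 / s ≤ 0 := (one_div_neg.2 hs).le
  have hms : 0 < m ^ s := Real.rpow_pos_of_pos hm s
  have hmm : (m ^ s) ^ (1 / s) = m := by
    rw [← Real.rpow_mul hm.le, mul_one_div_cancel hs.ne, Real.rpow_one]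
  set ε := (2 * m ^ s) ^ (1 / s) with hε
  have hε0 : 0 < ε := by positivity
  have hεm : ε ≤ m := by
    rw [← hmm]; exact Real.rpow_le_rpow_of_nonpos hms (by linarith) hs'
  set V := volume.real (Metric.ball (0 : EuclideanSpace ℝ (Fin d)) (δ / 2)) with hV
  have hVpos : 0 < V := volume_real_ball_pos _ (by positivity)
  -- almost all of the limit mass, hence of the mass of `νn n`, lies in one ball
  have hcont : Tendsto (fun k : ℕ => (ν : Measure (EuclideanSpace ℝ (Fin d))).real
      (Metric.ball z k)) atTop (𝓝 1) := by
    have h := tendsto_measure_iUnion_atTop (μ := (ν : Measure (EuclideanSpace ℝ (Fin d))))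
      (s := fun k : ℕ => Metric.ball z k)
      (fun a b hab => Metric.ball_subset_ball (by exact_mod_cast hab))
    rw [Metric.iUnion_ball_nat, measure_univ] at h
    exact (ENNReal.tendsto_toReal ENNReal.one_ne_top).comp h
  obtain ⟨k, hk⟩ := (hcont.eventually_const_lt
    (show 1 - ε * V < 1 by linarith [mul_pos hε0 hVpos])).exists
  -- Midpoints between `z` and the sphere of radius `R` are at distance `k + δ / 2`, so their `δ /
  -- 2`-balls miss `ball z k`.
  set R : ℝ := 2 * k + δ with hR
  have hR0 : 0 < R := by positivity
  have hlt : ∀ᶠ n in atTop, ∀ y, ‖y - z‖ = R → fn n y < ε := by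
    filter_upwards [(hf.tendsto_real_ball hweak z k).eventually_const_lt hk, hball]
      with n hn hzn y hy
    by_contra! hcon
    set w := (1 - 1 / 2 : ℝ) • y + (1 / 2 : ℝ) • z with hw
    have hlow : ∀ u ∈ Metric.ball w (δ / 2), ε ≤ fn n u := fun u hu => by
      have h := (hfn_conc n).mean_le_on_ball hs hε0 hε0 hcon
        (fun u hu => hεm.trans (hzn u hu)) (θ := 1 / 2) (by norm_num) (by norm_num) u
        (by rwa [show 1 / 2 * δ = δ / 2 by ring])
      rwa [show (1 - 1 / 2 : ℝ) * ε ^ s + 1 / 2 * ε ^ s = ε ^ s by ring, ← Real.rpow_mul hε0.le,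
        mul_one_div_cancel hs.ne, Real.rpow_one] at h
    have hmass := (hfn n).mul_volume_le hε0.le hlow
    rw [Measure.addHaar_real_ball_center, ← hV] at hmass
    have hdisj : Disjoint (Metric.ball z k) (Metric.ball w (δ / 2)) := by
      refine Metric.ball_disjoint_ball ?_
      rw [dist_comm, dist_eq_norm, show w - z = (1 / 2 : ℝ) • (y - z) by rw [hw]; module,
        norm_smul, hy, hR]
      norm_num; linarith
    have h1 := measureReal_union (μ := (νn n : Measure (EuclideanSpace ℝ (Fin d)))) hdisj
      Metric.isOpen_ball.measurableSet
    have h2 := measureReal_le_one (μ := (νn n : Measure (EuclideanSpace ℝ (Fin d))))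
      (s := Metric.ball z k ∪ Metric.ball w (δ / 2))
    linarith
  set A := 1 + ‖z‖ + R with hA
  have hA0 : 0 < A := by positivity
  refine ⟨max H m * (A⁻¹) ^ (1 / s), ?_⟩
  filter_upwards [hlt, hball] with n hn hzn x
  have hx0 : 0 < 1 + ‖x‖ := by positivity
  rw [mul_assoc, ← Real.mul_rpow (by positivity) hx0.le]
  have hxz : ‖x‖ ≤ ‖z‖ + ‖x - z‖ := by
    simpa using norm_add_le z (x - z)
  rcases le_or_gt ‖x - z‖ R with hle | hgt
  · have h1 : 1 ≤ (A⁻¹ * (1 + ‖x‖)) ^ (1 / s) := by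
      refine Real.one_le_rpow_of_pos_of_le_one_of_nonpos (by positivity) ?_ hs'
      rw [inv_mul_le_iff₀ hA0]; linarith
    calc fn n x ≤ H := hHbd _ _ z (hfn n) (hfn_conc n) hzn x
      _ ≤ max H m * 1 := by rw [mul_one]; exact le_max_left _ _
      _ ≤ _ := by gcongr
  -- The segment from `z` to `x` meets the sphere at parameter `t`; too large a value at `x` would
  -- give at least `ε` there, as `(1 - t) * m ^ s + m ^ s ≤ 2 * m ^ s`.
  · set t := R / ‖x - z‖ with ht
    have hxz0 : 0 < ‖x - z‖ := hR0.trans hgt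
    have ht0 : 0 < t := by positivity
    have ht1 : t < 1 := (div_lt_one hxz0).2 hgt
    have hc0 : 0 < (m ^ s / t) ^ (1 / s) := by positivity
    have hfx : fn n x < (m ^ s / t) ^ (1 / s) := by
      by_contra! hcon
      have h := (hfn_conc n).mean_le hs hm hc0 (hzn z (Metric.mem_ball_self hδ)) hcon ht0 ht1
      have hy : ‖(1 - t) • z + t • x - z‖ = R := by
        rw [show (1 - t) • z + t • x - z = t • (x - z) by module, norm_smul,
          Real.norm_of_nonneg ht0.le, ht, div_mul_cancel₀ _ hxz0.ne']
      refine absurd (hn _ hy) (not_lt.2 (le_trans ?_ h))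
      rw [← Real.rpow_mul (by positivity), one_div_mul_cancel hs.ne, Real.rpow_one,
        mul_div_cancel₀ _ ht0.ne', hε]
      refine Real.rpow_le_rpow_of_nonpos ?_ ?_ hs'
      · have : 0 < 1 - t := by linarith
        positivity
      · nlinarith
    have hbase : A⁻¹ * (1 + ‖x‖) ≤ t⁻¹ := by
      rw [ht, inv_div, inv_mul_le_iff₀ hA0, mul_div_assoc', le_div_iff₀ hR0, hA]
      nlinarith [norm_nonneg z]
    calc fn n x ≤ (m ^ s / t) ^ (1 / s) := hfx.le
      _ = m * (t⁻¹) ^ (1 / s) := by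
        rw [div_eq_mul_inv, Real.mul_rpow hms.le (by positivity), hmm]
      _ ≤ max H m * (A⁻¹ * (1 + ‖x‖)) ^ (1 / s) := by
        exact mul_le_mul (le_max_right _ _)
          (Real.rpow_le_rpow_of_nonpos (by positivity) hbase hs') (by positivity)
          (hm.le.trans (le_max_right _ _))

/-- The constant sequence converges weakly, so the uniform bound applies to it. -/
theorem IsLebesgueDensity.exists_le_rpow {d : ℕ} {s : ℝ} (hs : s < 0) (hsd : 1 / s + d < 0)
    {f : EuclideanSpace ℝ (Fin d) → ℝ} {ν : ProbabilityMeasure (EuclideanSpace ℝ (Fin d))}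
    (hf : IsLebesgueDensity f ν) (hf_usc : UpperSemicontinuous f) (hf_conc : IsSConcave s f) :
    ∃ K, ∀ x, f x ≤ K * (1 + ‖x‖) ^ (1 / s) := by
  obtain ⟨K, hK⟩ := eventually_le_rpow_of_weak hs hsd hf hf_conc (fun _ => hf) (fun _ => hf_usc)
    (fun _ => hf_conc) (tendsto_const_nhds (f := (atTop : Filter ℕ)) (x := ν))
  exact ⟨K, hK.exists.choose_spec⟩

/-! ### Dominated convergence -/

/-- The double negation in the exponent matches `integrable_one_add_norm`. -/
theorem norm_weight_mul_abs_sub_le {E : Type*} [NormedAddCommGroup E] {g h : E → ℝ}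
    {κ ρ K L : ℝ} {x : E} (hg0 : 0 ≤ g x) (hh0 : 0 ≤ h x) (hg : g x ≤ K * (1 + ‖x‖) ^ ρ)
    (hh : h x ≤ L * (1 + ‖x‖) ^ ρ) :
    ‖(1 + ‖x‖) ^ κ * |g x - h x|‖ ≤ (K + L) * (1 + ‖x‖) ^ (-(-(κ + ρ))) := by
  have hx : 0 < 1 + ‖x‖ := by positivity
  rw [Real.norm_of_nonneg (by positivity), neg_neg, Real.rpow_add hx]
  calc (1 + ‖x‖) ^ κ * |g x - h x| ≤ (1 + ‖x‖) ^ κ * ((K + L) * (1 + ‖x‖) ^ ρ) := by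
        gcongr
        rw [abs_le]; constructor <;> linarith
    _ = _ := by ring

theorem mainTheorem12 (d : ℕ) (hd : 1 ≤ d) (s : ℝ) (hs : -(1 / (d : ℝ)) < s) (hs0 : s < 0)
    (ν : ProbabilityMeasure (EuclideanSpace ℝ (Fin d)))
    (νn : ℕ → ProbabilityMeasure (EuclideanSpace ℝ (Fin d)))
    (f : EuclideanSpace ℝ (Fin d) → ℝ) (fn : ℕ → EuclideanSpace ℝ (Fin d) → ℝ)
    (hf : IsLebesgueDensity f ν) (hf_usc : UpperSemicontinuous f) (hf_conc : IsSConcave s f)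
    (hfn : ∀ n, IsLebesgueDensity (fn n) (νn n)) (hfn_usc : ∀ n, UpperSemicontinuous (fn n))
    (hfn_conc : ∀ n, IsSConcave s (fn n))
    (hweak : Tendsto νn atTop (𝓝 ν))
    (κ : ℝ) (hκ : κ < -(1 / s) - (d : ℝ)) :
    (∀ n, Integrable (fun x => (1 + ‖x‖) ^ κ * |fn n x - f x|)
        (volume : Measure (EuclideanSpace ℝ (Fin d)))) ∧
      Tendsto (fun n => ∫ x : EuclideanSpace ℝ (Fin d), (1 + ‖x‖) ^ κ * |fn n x - f x|)
        atTop (𝓝 0) := by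
  have hd0 : (0 : ℝ) < d := by exact_mod_cast hd
  have hsd : 1 / s + d < 0 := by
    have h1 : 0 < d * s + 1 := by
      have := mul_lt_mul_of_pos_left hs hd0
      rw [mul_neg, mul_one_div_cancel hd0.ne'] at this
      linarith
    rw [show 1 / s + d = (d * s + 1) / s by
      rw [add_div, mul_div_cancel_right₀ _ hs0.ne]; ring]
    exact div_neg_of_pos_of_neg h1 hs0
  have hmeas : ∀ n, AEStronglyMeasurable (fun x => (1 + ‖x‖) ^ κ * |fn n x - f x|)
      (volume : Measure (EuclideanSpace ℝ (Fin d))) := fun n => by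
    have h1 := (hfn n).1
    have h2 := hf.1
    refine Measurable.aestronglyMeasurable ?_
    fun_prop
  have hint : ∀ C : ℝ, Integrable (fun x => C * (1 + ‖x‖) ^ (-(-(κ + 1 / s))))
      (volume : Measure (EuclideanSpace ℝ (Fin d))) := fun C =>
    (integrable_one_add_norm (by rw [finrank_euclideanSpace_fin]; linarith)).const_mul C
  obtain ⟨L, hL⟩ := hf.exists_le_rpow hs0 hsd hf_usc hf_conc
  constructor
  · intro n
    obtain ⟨K, hK⟩ := (hfn n).exists_le_rpow hs0 hsd (hfn_usc n) (hfn_conc n)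
    exact (hint (K + L)).mono' (hmeas n) (.of_forall fun x =>
      norm_weight_mul_abs_sub_le ((hfn n).2.1 x) (hf.2.1 x) (hK x) (hL x))
  · obtain ⟨K, hK⟩ := eventually_le_rpow_of_weak hs0 hsd hf hf_conc hfn hfn_usc hfn_conc hweak
    have h := tendsto_integral_filter_of_dominated_convergence (f := fun _ => (0 : ℝ)) _
      (.of_forall hmeas)
      (hK.mono fun n hn => .of_forall fun x =>
        norm_weight_mul_abs_sub_le (κ := κ) ((hfn n).2.1 x) (hf.2.1 x) (hn x) (hL x))
      (hint (K + L)) ?_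
    · simpa using h
    filter_upwards [ae_tendsto_of_weak hs0 hf hf_usc hf_conc hfn hfn_usc hfn_conc hweak] with x hx
    have := ((hx.sub_const (f x)).abs).const_mul ((1 + ‖x‖) ^ κ)
    simpa using this
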